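/- **Setting.** A finite MDP $\mathcal M=(S,A,\delta)$ has finite sets $S$ of states and $A$ of actions and a partial function $\delta$ from $S\times A$ to probability distributions on $S$; $A(s)$ is the set of actions $a$ for which $\delta(s,a)$ is defined, and $A(s)\neq\emptyset$ for all $s$. A run is a sequence $\rho=s_0a_0s_1a_1\ldots$ with $\delta(s_i,a_i)(s_{i+1})>0$ for all $i$, and $\rho[n,\infty]=s_na_ns_{n+1}\ldots$. A sub-MDP consists of $S'\subseteq S$ and sets $\emptyset\ne A'(s)\subseteq A(s)$, $s\in S'$, with $\mathrm{Supp}(\delta(s,a))\subseteq S'$ for $a\in A'(s)$; it is an end-component (EC) of $\mathcal M$ if it is nonempty and its underlying graph is strongly connected. A sub-EC of an EC $\mathcal C$ is a sub-MDP of $\mathcal C$ that is an EC of $\mathcal M$. A strategy maps each history to a distribution on the actions available in its last state; it is pure if all these distributions are Dirac. It is $K$-memory if it is encoded by a Mealy machine with $K$ memory states, whose update depends on the current action, state and memory state; it is memoryless if $K=1$. An event is sure from $s$ under $\sigma$ if every run from $s$ consistent with $\sigma$ belongs to it, and almost sure if it has probability $1$ under the induced measure. **Objectives.** Let $\Omega=\mathsf{mp}$,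 with a weight function $w:A\to\mathbb Z$, or $\Omega=\mathsf{par}$, with a priority function $p:S\to\mathbb N$. For an integer $\lambda>0$, let $\mathsf{GW}_{\mathsf{mp}}(\lambda)$ be the set of runs such that $\frac1{l+1}\sum_{i=0}^{l}w(a_i)\ge0$ for some $0\le l<\lambda$, and $\mathsf{GW}_{\mathsf{par}}(\lambda)$ the set of runs such that, for some $0\le l<\lambda$, $p(s_l)$ is even and $p(s_l)<p(s_k)$ for all $k<l$. Put $$\mathsf{DFW}_\Omega(\lambda)=\{\rho\mid\forall j\ge0,\ \rho[j,\infty]\in\mathsf{GW}_\Omega(\lambda)\},\qquad \mathsf{FW}_\Omega(\lambda)=\{\rho\mid\exists i\ge0,\ \rho[i,\infty]\in\mathsf{DFW}_\Omega(\lambda)\},$$ $\mathsf{BW}_\Omega=\bigcup_{\lambda>0}\mathsf{FW}_\Omega(\lambda)$ and $\mathsf{DBW}_\Omega=\bigcup_{\lambda>0}\mathsf{DFW}_\Omega(\lambda)$. An EC $\mathcal C$ is $\lambda$-safe$_\Omega$ if some strategy in $\mathcal C$ surely satisfies $\mathsf{DFW}_\Omega(\lambda)$ from all states of $\mathcal C$.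 It is $\lambda$-good$_\Omega$ if it has a $\lambda$-safe$_\Omega$ sub-EC, and $\mathsf{BW}$-good$_\Omega$ if it has a sub-EC that is $\lambda$-safe$_\Omega$ for some $\lambda>0$. **Proposition.** 1. There is a polynomial $P$ with natural-number coefficients such that for every finite MDP $\mathcal M$, every $\Omega\in\{\mathsf{mp},\mathsf{par}\}$ (with any weight or priority function), every $\lambda>0$ and every $\lambda$-good$_\Omega$ EC $\mathcal C$ of $\mathcal M$ with state set $S_{\mathcal C}$, there is a pure strategy $\sigma$ in $\mathcal C$ that is $K$-memory for some $K\le P(|S_{\mathcal C}|+\lambda)$ and satisfies $\mathsf{FW}_\Omega(\lambda)$ almost surely from all states of $\mathcal C$. Moreover there is a $\lambda$-safe$_\Omega$ sub-EC $\mathcal C'$ of $\mathcal C$ such that, from every state of $\mathcal C$, $\sigma$ almost surely reaches $\mathcal C'$, and surely, from the first visit of $\mathcal C'$ on (if there is one), the play stays in $\mathcal C'$ and satisfies $\mathsf{DFW}_\Omega(\lambda)$. 2. For every finite MDP $\mathcal M$, every $\Omega\in\{\mathsf{mp},\mathsf{par}\}$ and every $\mathsf{BW}$-good$_\Omega$ EC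 $\mathcal C$ of $\mathcal M$, there is a pure memoryless strategy $\sigma$ in $\mathcal C$ that satisfies $\mathsf{BW}_\Omega$ almost surely from all states of $\mathcal C$. Moreover there is a sub-EC $\mathcal C'$ of $\mathcal C$, $\lambda$-safe$_\Omega$ for some $\lambda>0$, such that, from every state of $\mathcal C$, $\sigma$ almost surely reaches $\mathcal C'$, and surely, from the first visit of $\mathcal C'$ on (if there is one), the play stays in $\mathcal C'$ and satisfies $\mathsf{DBW}_\Omega$. -/

import Mathlib

open MeasureTheory ProbabilityTheory

universe u v

/-! ### Markov decision processes, sub-MDPs and end-components -/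

/-- A Markov decision process whose states are elements of `S` and whose actions are elements
of `A`. The state set is the finite set `states`; the transition function is partial on
`states × A` (`none` means undefined), maps into distributions over `states`, and there are no
deadlocks. The set of states is explicit so that a sub-MDP is again an MDP over the same types. -/
structure MDP (S A : Type*) where
  states : Finset S
  δ : S → A → Option (PMF S)
  dom : ∀ s a, (δ s a).isSome → s ∈ states
  closed : ∀ s a d, δ s a = some d → ∀ t ∈ d.support, t ∈ states
  deadlockFree : ∀ s ∈ states, ∃ a, (δ s a).isSome

/-- An infinite sequence `s₀ a₀ s₁ a₁ …` of states and actions: `ρ i = (sᵢ, aᵢ)`. -/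
abbrev Run (S A : Type*) := ℕ → S × A

namespace Run

/-- The suffix `ρ[n, ∞]`. -/
def suffix {S A : Type*} (ρ : Run S A) (n : ℕ) : Run S A := fun i => ρ (n + i)

/-- The word `s₀ a₀ … sₙ₋₁ aₙ₋₁` preceding the `n`-th state, stored with its last letter first. -/
def past {S A : Type*} (ρ : Run S A) : ℕ → List (S × A)
  | 0 => []
  | n + 1 => ρ n :: past ρ n

end Run

namespace MDP

/-- `A(s)`: the actions available in `s`. -/
def avail {S A : Type*} (M : MDP S A) (s : S) : Set A := {a | (M.δ s a).isSome}

/-- `(s, a, t) ∈ δ`: the action `a` is available in `s` and leads to `t` with positive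
probability. -/
def Step {S A : Type*} (M : MDP S A) (s : S) (a : A) (t : S) : Prop :=
  ∃ d, M.δ s a = some d ∧ t ∈ d.support

/-- The infinite sequence `ρ` is a run of `M`. -/
def IsRun {S A : Type*} (M : MDP S A) (ρ : Run S A) : Prop :=
  ∀ i, M.Step (ρ i).1 (ρ i).2 (ρ (i + 1)).1

/-- `M.IsHistory h s`: the finite sequence formed by the word `h` (last letter first) followed
by the state `s` is a history of `M`; `s` is its last state. -/
def IsHistory {S A : Type*} (M : MDP S A) : List (S × A) → S → Prop
  | [], s => s ∈ M.states
  | (t, a) :: h, s => M.IsHistory h t ∧ M.Step t a s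

/-- `M'` is a sub-MDP of `M`: its transition function is a restriction of that of `M`. That
`∅ ≠ A'(s)` and `Supp (δ (s, a)) ⊆ S'` holds because `M'` is itself an MDP. -/
def IsSubMDP {S A : Type*} (M' M : MDP S A) : Prop :=
  M'.states ⊆ M.states ∧ ∀ s a d, M'.δ s a = some d → M.δ s a = some d

/-- Every state can be reached from every state in the underlying graph. -/
def StronglyConnected {S A : Type*} (M : MDP S A) : Prop :=
  ∀ s ∈ M.states, ∀ t ∈ M.states, Relation.ReflTransGen (fun x y => ∃ a, M.Step x a y) s t

/-- `C` is an end-component of `M`: a nonempty strongly connected sub-MDP. -/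
def IsEC {S A : Type*} (C M : MDP S A) : Prop :=
  C.IsSubMDP M ∧ C.states.Nonempty ∧ C.StronglyConnected

/-- `C'` is a sub-EC of the end-component `C` of `M`. -/
def IsSubEC {S A : Type*} (C' C M : MDP S A) : Prop :=
  C'.IsSubMDP C ∧ C'.IsEC M

/-! ### Strategies -/

/-- A (history-dependent, randomized) strategy: `dist h s` is the distribution over actions
chosen after the history `h s`. Its values on sequences that are not histories are irrelevant. -/
structure Strategy {S A : Type*} (M : MDP S A) where
  dist : List (S × A) → S → PMF A
  avail : ∀ h s, M.IsHistory h s → ∀ a ∈ (dist h s).support, a ∈ M.avail s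

/-- A Mealy machine over `M` with set of memory states `Q` and a deterministic initial memory
state. -/
structure Mealy {S A : Type*} (M : MDP S A) (Q : Type*) where
  init : Q
  act : S → Q → PMF A
  upd : A → S → Q → Q
  avail : ∀ s ∈ M.states, ∀ q, ∀ a ∈ (act s q).support, a ∈ M.avail s

/-- The memory state reached after reading a word `s₀ a₀ … sₙ₋₁ aₙ₋₁` (last letter first). -/
def Mealy.mem {S A : Type*} {M : MDP S A} {Q : Type*} (m : M.Mealy Q) : List (S × A) → Q
  | [] => m.init
  | (s, a) :: h => m.upd a s (m.mem h)

namespace Strategy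

/-- All histories are mapped to Dirac distributions. -/
def IsPure {S A : Type*} {M : MDP S A} (σ : M.Strategy) : Prop :=
  ∀ h s, M.IsHistory h s → ∃ a, σ.dist h s = PMF.pure a

/-- The strategy is encoded by the Mealy machine. -/
def EncodedBy {S A : Type*} {M : MDP S A} {Q : Type*} (σ : M.Strategy) (m : M.Mealy Q) : Prop :=
  ∀ h s, M.IsHistory h s → σ.dist h s = m.act s (m.mem h)

/-- The strategy is `K`-memory: it is encoded by a Mealy machine with `K` memory states. -/
def HasMemory {S A : Type*} {M : MDP S A} (σ : M.Strategy) (K : ℕ) : Prop :=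
  ∃ m : M.Mealy (Fin K), σ.EncodedBy m

/-- A memoryless strategy is a `1`-memory one. -/
def IsMemoryless {S A : Type*} {M : MDP S A} (σ : M.Strategy) : Prop := σ.HasMemory 1

/-- `ρ` is a run from `s` consistent with the strategy `σ` (the projection to `M` of a run of the
induced Markov chain). -/
def IsOutcome {S A : Type*} {M : MDP S A} (σ : M.Strategy) (s : S) (ρ : Run S A) : Prop :=
  M.IsRun ρ ∧ (ρ 0).1 = s ∧ ∀ i, (ρ i).2 ∈ (σ.dist (ρ.past i) (ρ i).1).support

/-- The event `E` is sure from `s` under `σ`. -/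
def Sure {S A : Type*} {M : MDP S A} (σ : M.Strategy) (s : S) (E : Set (Run S A)) : Prop :=
  ∀ ρ, σ.IsOutcome s ρ → ρ ∈ E

end Strategy

end MDP

/-! ### The probability measure on runs -/

noncomputable section

/-- Letters `(s, a)` carry the discrete σ-algebra, so that `Run S A` carries the σ-algebra
generated by the cylinders. -/
abbrev letterMeasurableSpace (S A : Type*) : MeasurableSpace (S × A) := ⊤

namespace MDP.Strategy

section RunMeasure

attribute [local instance] letterMeasurableSpace

/-- The law of the next letter `(s', a')` after the word `h` followed by the letter `x = (s, a)`:
`s'` is drawn from `δ (s, a)`, then `a'` from the strategy. If `δ (s, a)` is undefined (which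
has probability zero), a dummy value is used. -/
def nextLetter {S A : Type*} {M : MDP S A} (σ : M.Strategy) (h : List (S × A)) (x : S × A) :
    PMF (S × A) :=
  match M.δ x.1 x.2 with
  | none => PMF.pure x
  | some d => d.bind fun s' => (σ.dist (x :: h) s').map fun a' => (s', a')

/-- The word `x₀ … xₙ`, seen as an infinite one that is constant from `n` on. -/
def extend {S A : Type*} (n : ℕ) (x : (i : Finset.Iic n) → S × A) : Run S A :=
  fun i => x ⟨min i n, Finset.mem_Iic.2 (min_le_right i n)⟩

/-- The transition kernel from words `x₀ … xₙ` to the next letter. -/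
def stepKernel {S A : Type*} [Finite S] [Finite A] {M : MDP S A} (σ : M.Strategy) (n : ℕ) :
    Kernel ((i : Finset.Iic n) → S × A) (S × A) :=
  Kernel.ofFunOfCountable fun x =>
    (σ.nextLetter ((extend n x).past n) (extend n x n)).toMeasure

instance {S A : Type*} [Finite S] [Finite A] {M : MDP S A} (σ : M.Strategy) (n : ℕ) :
    IsMarkovKernel (σ.stepKernel n) :=
  ⟨fun x => inferInstanceAs (IsProbabilityMeasure
    (σ.nextLetter ((extend n x).past n) (extend n x n)).toMeasure)⟩

/-- The law of the first letter `(s, a)`: `s` is the initial state and `a` is drawn from the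
strategy. -/
def firstLetter {S A : Type*} {M : MDP S A} (σ : M.Strategy) (s : S) :
    PMF ((_ : Finset.Iic 0) → S × A) :=
  (σ.dist [] s).map fun a _ => (s, a)

/-- The probability measure on runs induced by the strategy `σ` and the initial state `s`,
obtained from the transition kernels by the Ionescu-Tulcea theorem. -/
def runMeasure {S A : Type*} [Finite S] [Finite A] {M : MDP S A} (σ : M.Strategy) (s : S) :
    Measure (Run S A) :=
  (σ.firstLetter s).toMeasure.bind (Kernel.traj (X := fun _ => S × A) σ.stepKernel 0)

/-- The event `E` is almost sure from `s` under `σ`. -/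
def AlmostSure {S A : Type*} [Finite S] [Finite A] {M : MDP S A} (σ : M.Strategy) (s : S)
    (E : Set (Run S A)) : Prop :=
  σ.runMeasure s E = 1

end RunMeasure

end MDP.Strategy

end

/-! ### Window objectives -/

/-- The two kinds of window objectives with their data: mean-payoff for a weight function on
actions, and parity for a priority function on states. -/
inductive WindowKind (S A : Type*) where
  | mp (w : A → ℤ) : WindowKind S A
  | par (p : S → ℕ) : WindowKind S A

/-- The mean-payoff of the prefix `ρ[0, n]`, for `n > 0`. -/
def Run.meanPayoff {S A : Type*} (w : A → ℤ) (ρ : Run S A) (n : ℕ) : ℚ :=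
  (1 / (n : ℚ)) * ∑ i ∈ Finset.range n, (w (ρ i).2 : ℚ)

namespace MDP

/-- The good window objective. -/
def GW {S A : Type*} (M : MDP S A) : WindowKind S A → ℕ → Set (Run S A)
  | .mp w, lam => {ρ | M.IsRun ρ ∧ ∃ l < lam, 0 ≤ ρ.meanPayoff w (l + 1)}
  | .par p, lam => {ρ | M.IsRun ρ ∧
      ∃ l < lam, p (ρ l).1 % 2 = 0 ∧ ∀ k < l, p (ρ l).1 < p (ρ k).1}

/-- The direct fixed window objective. -/
def DFW {S A : Type*} (M : MDP S A) (Ω : WindowKind S A) (lam : ℕ) : Set (Run S A) :=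
  {ρ | M.IsRun ρ ∧ ∀ j, ρ.suffix j ∈ M.GW Ω lam}

/-- The fixed window objective. -/
def FW {S A : Type*} (M : MDP S A) (Ω : WindowKind S A) (lam : ℕ) : Set (Run S A) :=
  {ρ | M.IsRun ρ ∧ ∃ i, ρ.suffix i ∈ M.DFW Ω lam}

/-- The bounded window objective. -/
def BW {S A : Type*} (M : MDP S A) (Ω : WindowKind S A) : Set (Run S A) :=
  {ρ | M.IsRun ρ ∧ ∃ lam > 0, ρ ∈ M.FW Ω lam}

/-- The direct bounded window objective. -/
def DBW {S A : Type*} (M : MDP S A) (Ω : WindowKind S A) : Set (Run S A) :=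
  {ρ | ∃ lam > 0, ρ ∈ M.DFW Ω lam}

/-! ### Safe and good end-components -/

/-- The end-component `C` is `lam`-safe: some strategy in `C` surely satisfies the direct fixed
window objective from all states of `C`. -/
def IsSafe {S A : Type*} (C : MDP S A) (Ω : WindowKind S A) (lam : ℕ) : Prop :=
  ∃ σ : C.Strategy, ∀ s ∈ C.states, σ.Sure s (C.DFW Ω lam)

/-- The end-component `C` of `M` is `lam`-good: it contains a `lam`-safe sub-EC. -/
def IsGood {S A : Type*} (C M : MDP S A) (Ω : WindowKind S A) (lam : ℕ) : Prop :=
  ∃ C' : MDP S A, C'.IsSubEC C M ∧ C'.IsSafe Ω lam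

/-- The end-component `C` of `M` is BW-good: it contains a sub-EC that is `lam`-safe for some
`lam > 0`. -/
def IsBWGood {S A : Type*} (C M : MDP S A) (Ω : WindowKind S A) : Prop :=
  ∃ C' : MDP S A, C'.IsSubEC C M ∧ ∃ lam > 0, C'.IsSafe Ω lam

/-- From every state of `C`, the strategy `σ` in `C` almost surely reaches `C'`, and surely (on
every consistent run), from the first visit of `C'` on the play is a run of `C'` satisfying
`E`, i.e. the strategy then stays in `C'` and is surely winning there for `E`. -/
def Strategy.ReachesThenWins {S A : Type*} [Finite S] [Finite A] {C : MDP S A}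
    (σ : C.Strategy) (C' : MDP S A) (E : Set (Run S A)) : Prop :=
  ∀ s ∈ C.states,
    σ.AlmostSure s {ρ | ∃ i, (ρ i).1 ∈ C'.states} ∧
    σ.Sure s {ρ | ∀ i, (ρ i).1 ∈ C'.states → (∀ j < i, (ρ j).1 ∉ C'.states) →
      C'.IsRun (ρ.suffix i) ∧ ρ.suffix i ∈ E}

end MDP

/-!
Both window objectives can be described by an integer counter that is monotone in its previous
value: a window opens at `0` and closes as soon as the counter is nonnegative again. Hence, for each
state and each number of remaining steps, the counter values from which an action wins form an upper
set. These sets are nested, so one action is optimal for all counter values at once.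

*Fixed length.* It therefore suffices to remember the number of remaining steps of the current
window, which gives `lam` memory states. A window opened while another one is still open starts with
a larger counter value and so, by monotonicity, closes no later.

*Unspecified length.* In a state `s`, play as if the counter had the least value `v s` from which
the window can be closed, with the least number `r s` of steps in which this is possible. As long as
a window is open, either the excess of the counter over `v` grows, or it does not decrease and `r`
drops. Both quantities are bounded, so windows close within a bounded number of steps.

Outside the safe end-component, the attractor strategy moves closer to it with probability bounded
away from zero, so it is reached almost surely.
-/

/-! ### Runs, sub-MDPs and outcomes -/

namespace Run

variable {S A : Type*}

theorem suffix_zero (ρ : Run S A) : ρ.suffix 0 = ρ := by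
  funext k
  simp [suffix]

theorem past_succ (ρ : Run S A) (n : ℕ) : ρ.past (n + 1) = ρ n :: ρ.past n := rfl

theorem past_congr {ρ ρ' : Run S A} : ∀ {n : ℕ}, (∀ i < n, ρ i = ρ' i) → ρ.past n = ρ'.past n
  | 0, _ => rfl
  | n + 1, h => by
    rw [past_succ, past_succ, h n n.lt_succ_self,
      past_congr fun i hi => h i (hi.trans n.lt_succ_self)]

theorem length_past (ρ : Run S A) : ∀ n, (ρ.past n).length = n
  | 0 => rfl
  | n + 1 => congrArg (· + 1) (length_past ρ n)

theorem exists_eq_of_mem_past {ρ : Run S A} {y : S × A} :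
    ∀ {n : ℕ}, y ∈ ρ.past n → ∃ i, ρ i = y
  | 0, h => by cases h
  | n + 1, h => by
    rcases List.mem_cons.1 h with rfl | h
    · exact ⟨n, rfl⟩
    · exact exists_eq_of_mem_past h

end Run

namespace MDP

variable {S A : Type*} {M M' : MDP S A}

theorem exists_step {s : S} {a : A} (ha : a ∈ M.avail s) : ∃ t, M.Step s a t := by
  obtain ⟨d, hd⟩ := Option.isSome_iff_exists.1 ha
  obtain ⟨t, ht⟩ := d.support_nonempty
  exact ⟨t, d, hd, ht⟩

theorem Step.mem_avail {s t : S} {a : A} (h : M.Step s a t) : a ∈ M.avail s := by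
  obtain ⟨d, hd, -⟩ := h
  exact Option.isSome_iff_exists.2 ⟨d, hd⟩

theorem Step.mem_states {s t : S} {a : A} (h : M.Step s a t) : t ∈ M.states := by
  obtain ⟨d, hd, ht⟩ := h
  exact M.closed s a d hd t ht

theorem IsRun.mem_states {ρ : Run S A} (hρ : M.IsRun ρ) (n : ℕ) : (ρ n).1 ∈ M.states :=
  M.dom _ _ (hρ n).mem_avail

theorem IsRun.suffix {ρ : Run S A} (hρ : M.IsRun ρ) (n : ℕ) : M.IsRun (ρ.suffix n) :=
  fun i => hρ (n + i)

theorem IsRun.isHistory_past {ρ : Run S A} (hρ : M.IsRun ρ) :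
    ∀ n, M.IsHistory (ρ.past n) (ρ n).1
  | 0 => hρ.mem_states 0
  | n + 1 => ⟨hρ.isHistory_past n, hρ n⟩

theorem IsHistory.mem_states : ∀ {h : List (S × A)} {s : S}, M.IsHistory h s → s ∈ M.states
  | [], _, h => h
  | _ :: _, _, h => h.2.mem_states

namespace IsSubMDP

theorem step (hsub : M'.IsSubMDP M) {s t : S} {a : A} (h : M'.Step s a t) : M.Step s a t := by
  obtain ⟨d, hd, ht⟩ := h
  exact ⟨d, hsub.2 s a d hd, ht⟩

theorem step_of_mem_avail (hsub : M'.IsSubMDP M) {s t : S} {a : A} (ha : a ∈ M'.avail s)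
    (h : M.Step s a t) : M'.Step s a t := by
  obtain ⟨d, hd⟩ := Option.isSome_iff_exists.1 ha
  obtain ⟨d', hd', ht⟩ := h
  obtain rfl := Option.some.inj ((hsub.2 s a d hd).symm.trans hd')
  exact ⟨d, hd, ht⟩

theorem avail_subset (hsub : M'.IsSubMDP M) (s : S) : M'.avail s ⊆ M.avail s := by
  intro a ha
  obtain ⟨t, ht⟩ := exists_step ha
  exact (hsub.step ht).mem_avail

theorem isRun (hsub : M'.IsSubMDP M) {ρ : Run S A} (hρ : M'.IsRun ρ) : M.IsRun ρ :=
  fun i => hsub.step (hρ i)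

theorem GW_subset (hsub : M'.IsSubMDP M) (Ω : WindowKind S A) (lam : ℕ) :
    M'.GW Ω lam ⊆ M.GW Ω lam := by
  cases Ω <;> exact fun _ hρ => ⟨hsub.isRun hρ.1, hρ.2⟩

theorem DFW_subset (hsub : M'.IsSubMDP M) (Ω : WindowKind S A) (lam : ℕ) :
    M'.DFW Ω lam ⊆ M.DFW Ω lam :=
  fun _ hρ => ⟨hsub.isRun hρ.1, fun j => hsub.GW_subset Ω lam (hρ.2 j)⟩

end IsSubMDP

theorem Strategy.exists_isOutcome (σ : M.Strategy) {s : S} (hs : s ∈ M.states)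
    {P : List (S × A) → S → Prop} (h0 : P [] s)
    (hstep : ∀ h u, P h u → ∀ a ∈ (σ.dist h u).support, a ∈ M.avail u →
      ∃ t, M.Step u a t ∧ P ((u, a) :: h) t) :
    ∃ ρ, σ.IsOutcome s ρ ∧ ∀ n, P (ρ.past n) (ρ n).1 := by
  let H := {y : List (S × A) × S // M.IsHistory y.1 y.2 ∧ P y.1 y.2}
  have hex (y : H) : ∃ x : A × S, x.1 ∈ (σ.dist y.1.1 y.1.2).support ∧ M.Step y.1.2 x.1 x.2 ∧
      P ((y.1.2, x.1) :: y.1.1) x.2 := by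
    obtain ⟨⟨h, u⟩, hh, hP⟩ := y
    obtain ⟨a, ha⟩ := (σ.dist h u).support_nonempty
    obtain ⟨t, ht, hPt⟩ := hstep h u hP a ha (σ.avail h u hh a ha)
    exact ⟨(a, t), ha, ht, hPt⟩
  choose f hmem hf hP using hex
  let g : ℕ → H := fun n => Nat.rec ⟨([], s), hs, h0⟩
    (fun _ y => ⟨((y.1.2, (f y).1) :: y.1.1, (f y).2), ⟨y.2.1, hf y⟩, hP y⟩) n
  let ρ : Run S A := fun n => ((g n).1.2, (f (g n)).1)
  have hpast (n : ℕ) : ρ.past n = (g n).1.1 := by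
    induction n with
    | zero => rfl
    | succ n ih => rw [Run.past_succ, ih]
  refine ⟨ρ, ⟨fun n => hf (g n), rfl, fun n => ?_⟩, fun n => ?_⟩
  · rw [hpast]
    exact hmem (g n)
  · rw [hpast]
    exact (g n).2.2

end MDP

/-! ### Window counters -/

/-- An integer counter describing a window objective. A window is opened with the value `0`, the
value is updated by `next` along the run, and the window is closed as soon as it is nonnegative
again. The number `excess x v` measures how far the value `x` is above `v`; while the window is open
it does not decrease when both values are updated. -/
structure WindowCounter (S A : Type*) where
  next : S → A → ℤ → ℤ
  excess : ℤ → ℤ → ℤ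
  next_mono : ∀ s a, Monotone (next s a)
  bddBelow_preimage : ∀ s a b, BddBelow (next s a ⁻¹' Set.Ici b)
  excess_mono : ∀ v, Monotone (excess · v)
  excess_strictAnti : ∀ x, StrictAnti (excess x)
  excess_le_excess_next : ∀ s a x v, v ≤ x → next s a x < 0 →
    excess x v ≤ excess (next s a x) (next s a v)

namespace WindowCounter

variable {S A : Type*} (c : WindowCounter S A)

/-- The value of the counter after reading a word (last letter first) from the value `x`. -/
def val (x : ℤ) : List (S × A) → ℤ
  | [] => x
  | y :: h => c.next y.1 y.2 (val x h)

/-- A window with current value `x` closes within the first `i` steps of `ρ`. -/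
def Closes (i : ℕ) (x : ℤ) (ρ : Run S A) : Prop := ∃ l < i, 0 ≤ c.val x (ρ.past (l + 1))

/-- The counter describes `Ω`: a run is in the good window objective if and only if a window opened
now closes in time. -/
def Describes (Ω : WindowKind S A) : Prop :=
  ∀ (M : MDP S A) lam, M.GW Ω lam = {ρ | M.IsRun ρ ∧ c.Closes lam 0 ρ}

variable {c}

theorem val_past_succ (x : ℤ) (ρ : Run S A) (n : ℕ) :
    c.val x (ρ.past (n + 1)) = c.next (ρ n).1 (ρ n).2 (c.val x (ρ.past n)) := rfl

theorem val_past_succ' (x : ℤ) (ρ : Run S A) (n : ℕ) :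
    c.val x (ρ.past (n + 1)) = c.val (c.next (ρ 0).1 (ρ 0).2 x) ((ρ.suffix 1).past n) := by
  induction n with
  | zero => rfl
  | succ n ih => rw [val_past_succ, ih, val_past_succ, Run.suffix, add_comm 1 n]

theorem Closes.of_next_nonneg {i : ℕ} {x : ℤ} {ρ : Run S A}
    (h : 0 ≤ c.next (ρ 0).1 (ρ 0).2 x) : c.Closes (i + 1) x ρ :=
  ⟨0, i.succ_pos, h⟩

theorem Closes.of_suffix {i : ℕ} {x : ℤ} {ρ : Run S A}
    (h : c.Closes i (c.next (ρ 0).1 (ρ 0).2 x) (ρ.suffix 1)) : c.Closes (i + 1) x ρ := by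
  obtain ⟨l, hl, h⟩ := h
  exact ⟨l + 1, by omega, by rwa [val_past_succ']⟩

theorem Describes.mem_DFW {Ω : WindowKind S A} (hc : c.Describes Ω) {M : MDP S A} {lam : ℕ}
    {ρ : Run S A} : ρ ∈ M.DFW Ω lam ↔ M.IsRun ρ ∧ ∀ j, c.Closes lam 0 (ρ.suffix j) := by
  rw [MDP.DFW, hc M lam]
  exact and_congr_right fun hρ => forall_congr' fun j => and_iff_right (hρ.suffix j)

/-! ### Mean-payoff counters -/

/-- The sum of the weights, which describes mean-payoff windows. -/
def meanPayoff (S : Type*) {A : Type*} (w : A → ℤ) : WindowCounter S A where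
  next _ a x := x + w a
  excess x v := x - v
  next_mono _ a x y h := by simpa only [add_le_add_iff_right] using h
  bddBelow_preimage _ a b := ⟨b - w a, fun _ h => sub_le_iff_le_add.2 h⟩
  excess_mono v x y h := by simpa only [sub_le_sub_iff_right] using h
  excess_strictAnti x v v' h := by simpa only [sub_lt_sub_iff_left] using h
  excess_le_excess_next _ a x v _ _ := (add_sub_add_right_eq_sub x v (w a)).ge

theorem val_meanPayoff (w : A → ℤ) (ρ : Run S A) (n : ℕ) :
    (meanPayoff S w).val 0 (ρ.past n) = ∑ i ∈ Finset.range n, w (ρ i).2 := by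
  induction n with
  | zero => rfl
  | succ n ih => rw [val_past_succ, ih, Finset.sum_range_succ]; rfl

theorem describes_meanPayoff (w : A → ℤ) : (meanPayoff S w).Describes (.mp w) := by
  have nonneg_iff (ρ : Run S A) (n : ℕ) :
      0 ≤ ρ.meanPayoff w (n + 1) ↔ 0 ≤ (meanPayoff S w).val 0 (ρ.past (n + 1)) := by
    rw [val_meanPayoff, Run.meanPayoff, mul_nonneg_iff_of_pos_left (by positivity),
      ← Int.cast_sum, Int.cast_nonneg_iff]
  intro M lam
  ext ρ
  exact and_congr_right fun _ => exists_congr fun l => and_congr_right fun _ => nonneg_iff ρ l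

/-! ### Parity counters -/

/-- The least priority of the open window, shifted by a strict bound `N` on all priorities so that
it is negative; it describes parity windows. The value is `0` exactly if the window has just been
opened or closed. -/
def parity {S : Type*} (A : Type*) (p : S → ℕ) (N : ℕ) (hN : ∀ s, p s < N) : WindowCounter S A where
  next s _ x := if p s % 2 = 0 ∧ (p s : ℤ) - N < x then 0 else min x (p s - N)
  excess _ v := -v
  next_mono s _ x y h := by
    have := hN s
    dsimp only
    split_ifs <;> omega
  bddBelow_preimage s _ b := ⟨min b (p s - N), fun _ (h : b ≤ ite _ _ _) => by
    split_ifs at h <;> omega⟩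
  excess_mono _ _ _ _ := le_rfl
  excess_strictAnti _ _ _ h := neg_lt_neg h
  excess_le_excess_next s _ x v h hx := by
    split_ifs at hx ⊢ <;> omega

section Parity

variable {p : S → ℕ} {N : ℕ} {hN : ∀ s, p s < N} {ρ : Run S A}

theorem lt_val_parity {z : ℤ} (hz : z < 0) {n : ℕ} (h : ∀ k < n, z < p (ρ k).1 - N) :
    z < (parity A p N hN).val 0 (ρ.past n) := by
  induction n with
  | zero => exact hz
  | succ n ih =>
    have h1 := ih fun k hk => h k (hk.trans n.lt_succ_self)
    have h2 := h n n.lt_succ_self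
    simp only [val_past_succ, parity] at h1 ⊢
    split_ifs <;> omega

theorem val_parity_le {l : ℕ} (hopen : ∀ k < l, (parity A p N hN).val 0 (ρ.past (k + 1)) < 0) :
    ∀ k < l, (parity A p N hN).val 0 (ρ.past l) ≤ p (ρ k).1 - N := by
  induction l with
  | zero => exact fun k hk => absurd hk k.not_lt_zero
  | succ l ih =>
    have h1 := hopen l l.lt_succ_self
    have h2 := ih fun k hk => hopen k (hk.trans l.lt_succ_self)
    simp only [val_past_succ, parity] at h1 h2 ⊢
    rw [if_neg fun hc => by rw [if_pos hc] at h1; exact h1.false]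
    intro k hk
    obtain hk | rfl := Nat.lt_succ_iff_lt_or_eq.1 hk
    · exact (min_le_left _ _).trans (h2 k hk)
    · exact min_le_right _ _

theorem closes_parity {i : ℕ} : (parity A p N hN).Closes i 0 ρ ↔
    ∃ l < i, p (ρ l).1 % 2 = 0 ∧ ∀ k < l, p (ρ l).1 < p (ρ k).1 := by
  have next_nonneg_iff (s : S) (a : A) (x : ℤ) :
      0 ≤ (parity A p N hN).next s a x ↔ p s % 2 = 0 ∧ (p s : ℤ) - N < x := by
    have := hN s
    simp only [parity]
    split_ifs <;> omega
  have priority_lt (l : ℕ) : (p (ρ l).1 : ℤ) - N < 0 := by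
    have := hN (ρ l).1
    omega
  classical
  constructor
  · intro h
    obtain ⟨hl, hclosed⟩ := Nat.find_spec h
    have hopen (k : ℕ) (hk : k < Nat.find h) : (parity A p N hN).val 0 (ρ.past (k + 1)) < 0 :=
      not_le.1 fun hk' => Nat.find_min h hk ⟨hk.trans hl, hk'⟩
    obtain ⟨heven, hlt⟩ := (next_nonneg_iff _ _ _).1 hclosed
    refine ⟨Nat.find h, hl, heven, fun k hk => ?_⟩
    have := hlt.trans_le (val_parity_le hopen k hk)
    omega
  · rintro ⟨l, hl, heven, hlt⟩
    refine ⟨l, hl, (next_nonneg_iff _ _ _).2 ⟨heven, lt_val_parity (priority_lt l) fun k hk => ?_⟩⟩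
    have := hlt k hk
    omega

theorem describes_parity : (parity A p N hN).Describes (.par p) := by
  intro M lam
  ext ρ
  exact and_congr_right fun _ => closes_parity.symm

end Parity

theorem exists_describes [Finite S] (Ω : WindowKind S A) :
    ∃ c : WindowCounter S A, c.Describes Ω := by
  cases Ω with
  | mp w => exact ⟨_, describes_meanPayoff w⟩
  | par p =>
    obtain ⟨N, hN⟩ := (Set.finite_range p).bddAbove
    exact ⟨_, describes_parity (hN := fun s => Nat.lt_succ_of_le (hN ⟨s, rfl⟩))⟩

end WindowCounter

/-! ### Controllers -/

/-- A deterministic Mealy machine without initial state: `act` chooses the next action and `upd`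
updates the memory. -/
structure Controller (S A Q : Type*) where
  act : S → Q → A
  upd : A → S → Q → Q

namespace Controller

variable {S A Q : Type*}

/-- The memory states `m` and the actions of `ρ` are those chosen by the controller; the initial
memory state is arbitrary. -/
def Follows (κ : Controller S A Q) (m : ℕ → Q) (ρ : Run S A) : Prop :=
  ∀ n, (ρ n).2 = κ.act (ρ n).1 (m n) ∧ m (n + 1) = κ.upd (ρ n).2 (ρ n).1 (m n)

theorem Follows.suffix {κ : Controller S A Q} {m : ℕ → Q} {ρ : Run S A} (h : κ.Follows m ρ)
    (n : ℕ) : κ.Follows (fun i => m (n + i)) (ρ.suffix n) :=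
  fun i => h (n + i)

end Controller

/-! ### The window game -/

namespace WindowCounter

variable {S A : Type*} (c : WindowCounter S A) (M : MDP S A)

/-- In the state `s` with counter value `x`, the window is closed or the controller can surely
close it within `i` steps. -/
def Win : ℕ → S → ℤ → Prop
  | 0, _, x => 0 ≤ x
  | i + 1, s, x => 0 ≤ x ∨ ∃ a ∈ M.avail s, ∀ t, M.Step s a t → Win i t (c.next s a x)

/-- After choosing `a` in `s` with counter value `x`, the controller wins within `i` further
steps. -/
def WinAct (i : ℕ) (s : S) (a : A) (x : ℤ) : Prop :=
  ∀ t, M.Step s a t → c.Win M i t (c.next s a x)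

/-- In `s` with counter value `x`, the controller can surely close the window by a step followed by
at most `i` further ones. In contrast to `Win`, at least one step has to be made. -/
def WinStep (i : ℕ) (s : S) (x : ℤ) : Prop := ∃ a ∈ M.avail s, c.WinAct M i s a x

/-- The action `f i s` is winning with `i` further steps for every counter value for which some
action is. -/
def IsOptimal (f : ℕ → S → A) : Prop :=
  ∀ i, ∀ s ∈ M.states, f i s ∈ M.avail s ∧ ∀ x, c.WinStep M i s x → c.WinAct M i s (f i s) x

variable {c M} {i j : ℕ} {s : S} {a : A} {x y : ℤ}

theorem win_of_nonneg (h : 0 ≤ x) : c.Win M i s x := by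
  cases i with
  | zero => exact h
  | succ i => exact Or.inl h

theorem Win.winStep (h : c.Win M (i + 1) s x) (hx : x < 0) : c.WinStep M i s x :=
  h.resolve_left hx.not_ge

theorem Win.mono (h : c.Win M i s x) (hxy : x ≤ y) : c.Win M i s y := by
  induction i generalizing s x y with
  | zero => exact le_trans h hxy
  | succ i ih =>
    rcases h with h | ⟨a, ha, h⟩
    · exact Or.inl (h.trans hxy)
    · exact Or.inr ⟨a, ha, fun t ht => ih (h t ht) (c.next_mono s a hxy)⟩

theorem WinAct.mono (h : c.WinAct M i s a x) (hxy : x ≤ y) : c.WinAct M i s a y :=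
  fun t ht => (h t ht).mono (c.next_mono s a hxy)

theorem WinStep.mono (h : c.WinStep M i s x) (hxy : x ≤ y) : c.WinStep M i s y := by
  obtain ⟨a, ha, h⟩ := h
  exact ⟨a, ha, h.mono hxy⟩

theorem Win.succ (h : c.Win M i s x) : c.Win M (i + 1) s x := by
  induction i generalizing s x with
  | zero => exact Or.inl h
  | succ i ih =>
    rcases h with h | ⟨a, ha, h⟩
    · exact Or.inl h
    · exact Or.inr ⟨a, ha, fun t ht => ih (h t ht)⟩

theorem Win.of_le (h : c.Win M i s x) (hij : i ≤ j) : c.Win M j s x := by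
  induction j, hij using Nat.le_induction with
  | base => exact h
  | succ j _ ih => exact ih.succ

theorem WinStep.of_le (h : c.WinStep M i s x) (hij : i ≤ j) : c.WinStep M j s x := by
  obtain ⟨a, ha, h⟩ := h
  exact ⟨a, ha, fun t ht => (h t ht).of_le hij⟩

variable (c) in
/-- The sets of counter values from which the actions win are upper sets and hence nested, so an
action for which this set is maximal is optimal for all values. -/
theorem exists_optimal_action [Finite A] (hs : s ∈ M.states) (i : ℕ) :
    ∃ a ∈ M.avail s, ∀ x, c.WinStep M i s x → c.WinAct M i s a x := by
  let W (a : A) : Set ℤ := {x | c.WinAct M i s a x}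
  have hW (a : A) : IsUpperSet (W a) := fun _ _ hxy hx => WinAct.mono hx hxy
  obtain ⟨a, ha, hmax⟩ :=
    (Set.toFinite (M.avail s)).exists_maximalFor W _ (M.deadlockFree s hs)
  refine ⟨a, ha, fun x ⟨b, hb, hbx⟩ => ?_⟩
  rcases (hW b).total (hW a) with h | h
  · exact h hbx
  · exact hmax hb h hbx

variable (c M) in
theorem exists_isOptimal [Finite A] [Nonempty A] : ∃ f : ℕ → S → A, c.IsOptimal M f := by
  have hex (i : ℕ) (s : S) : ∃ a, s ∈ M.states →
      a ∈ M.avail s ∧ ∀ x, c.WinStep M i s x → c.WinAct M i s a x := by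
    by_cases hs : s ∈ M.states
    · obtain ⟨a, ha⟩ := c.exists_optimal_action hs i
      exact ⟨a, fun _ => ha⟩
    · exact ⟨Classical.arbitrary A, fun h => absurd h hs⟩
  choose f hf using hex
  exact ⟨f, hf⟩

/-- If the window game is lost, then against every strategy the environment can keep it lost until
the time is over. -/
theorem winStep_of_sure (σ : M.Strategy) (hs : s ∈ M.states)
    (h : σ.Sure s {ρ | c.Closes (i + 1) x ρ}) : c.WinStep M i s x := by
  by_contra hlost
  let P (w : List (S × A)) (u : S) : Prop :=
    (∀ j, j + w.length = i → ¬c.WinStep M j u (c.val x w)) ∧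
      (w ≠ [] → w.length ≤ i + 1 → c.val x w < 0)
  have keep_losing (w : List (S × A)) (u : S) (hP : P w u) (a : A) (ha : a ∈ M.avail u) :
      ∃ t, M.Step u a t ∧ P ((u, a) :: w) t := by
    by_cases hw : w.length ≤ i
    · obtain ⟨j, rfl⟩ := Nat.exists_eq_add_of_le' hw
      have hlose : ¬c.WinAct M j u a (c.val x w) := fun h => hP.1 j rfl ⟨a, ha, h⟩
      simp only [WinAct, not_forall] at hlose
      obtain ⟨t, ht, hlose⟩ := hlose
      refine ⟨t, ht, fun k hk hwin => hlose ?_, fun _ _ => ?_⟩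
      · obtain rfl : j = k + 1 := by simp only [List.length_cons] at hk; omega
        exact Or.inr hwin
      · exact not_le.1 fun h => hlose (win_of_nonneg h)
    · obtain ⟨t, ht⟩ := MDP.exists_step ha
      refine ⟨t, ht, fun k hk => ?_, fun _ hk => ?_⟩ <;>
        simp only [List.length_cons] at hk <;> omega
  obtain ⟨ρ, hρ, hP⟩ := σ.exists_isOutcome hs (P := P)
    ⟨by rintro j rfl; exact hlost, fun h => absurd rfl h⟩ (fun w u hP a _ => keep_losing w u hP a)
  obtain ⟨l, hl, hclosed⟩ := h ρ hρ
  exact ((hP (l + 1)).2 (List.cons_ne_nil _ _) (by rwa [Run.length_past])).not_ge hclosed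

/-! ### Fixed window length: remembering the remaining steps -/

variable (c M) {f : ℕ → S → A} {L : ℕ}

open Classical in
/-- The number of further steps for which to play next, when `q` steps remain of the current window.
A new window of length `L + 1` is opened if no open window, of value at most `-1`, can still be
closed in time. -/
noncomputable def remaining (q : Fin (L + 1)) (s : S) : Fin (L + 1) :=
  if 0 < q.1 ∧ c.WinStep M (q - 1) s (-1) then ⟨q - 1, by omega⟩ else Fin.last L

/-- The controller that remembers the number of remaining steps of the current window. -/
noncomputable def fixedWindowController (f : ℕ → S → A) (L : ℕ) :
    Controller S A (Fin (L + 1)) where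
  act s q := f (c.remaining M q s) s
  upd _ s q := c.remaining M q s

variable {c M}

theorem winStep_remaining (h : c.WinStep M L s 0) (q : Fin (L + 1)) :
    c.WinStep M (c.remaining M q s) s 0 := by
  rw [remaining]
  split_ifs with hq
  · exact hq.2.mono (by norm_num)
  · exact h

theorem remaining_of_winStep {q : Fin (L + 1)} {k : ℕ} (hq : q.1 = k + 1)
    (h : c.WinStep M k s (-1)) : (c.remaining M q s).1 = k := by
  obtain rfl : k = q.1 - 1 := by omega
  rw [remaining, if_pos ⟨by omega, h⟩]

theorem closes_of_fixedWindowController (hf : c.IsOptimal M f) {k : ℕ} {x : ℤ}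
    {ρ : Run S A} (hρ : M.IsRun ρ) {m : ℕ → Fin (L + 1)}
    (hm : (c.fixedWindowController M f L).Follows m ρ) (hk : (m 1).1 = k)
    (h : c.WinStep M k (ρ 0).1 x) : c.Closes (k + 1) x ρ := by
  have hact (n : ℕ) : (ρ n).2 = f (m (n + 1)) (ρ n).1 :=
    (hm n).1.trans (congrArg (fun q : Fin (L + 1) => f q (ρ n).1) (hm n).2.symm)
  have hwin : c.Win M k (ρ 1).1 (c.next (ρ 0).1 (ρ 0).2 x) := by
    refine (?_ : c.WinAct M k (ρ 0).1 (ρ 0).2 x) _ (hρ 0)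
    rw [hact, hk]
    exact (hf k _ (hρ.mem_states 0)).2 x h
  rcases le_or_gt 0 (c.next (ρ 0).1 (ρ 0).2 x) with hclosed | hopen
  · exact .of_next_nonneg hclosed
  cases k with
  | zero => exact absurd hwin hopen.not_ge
  | succ k =>
    have hnext := hwin.winStep hopen
    have hrem : (m 2).1 = k :=
      (congrArg Fin.val (hm 1).2).trans (remaining_of_winStep hk (hnext.mono (by omega)))
    exact .of_suffix (closes_of_fixedWindowController hf (hρ.suffix 1) (hm.suffix 1) hrem hnext)

theorem closes_fixedWindow (hf : c.IsOptimal M f) (hL : ∀ s ∈ M.states, c.WinStep M L s 0)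
    {ρ : Run S A} (hρ : M.IsRun ρ) {m : ℕ → Fin (L + 1)}
    (hm : (c.fixedWindowController M f L).Follows m ρ) : c.Closes (L + 1) 0 ρ := by
  have hwin := winStep_remaining (hL _ (hρ.mem_states 0)) (m 0)
  rw [← show m 1 = c.remaining M (m 0) (ρ 0).1 from (hm 0).2] at hwin
  obtain ⟨l, hl, hclosed⟩ := closes_of_fixedWindowController hf hρ hm rfl hwin
  exact ⟨l, hl.trans_le (m 1).2, hclosed⟩

/-! ### Unspecified window length: least winning values -/

variable (c M) in
/-- The least counter value for which a window in `s` can still surely be closed within `L + 1`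
steps (a meaningless `0` if there is none). -/
noncomputable def threshold (L : ℕ) (s : S) : ℤ := sInf {x | c.WinStep M L s x}

variable (c M) in
/-- The least number of steps, after the next one, in which a window of value `threshold L s` can
surely be closed. -/
noncomputable def rank (L : ℕ) (s : S) : ℕ := sInf {k | c.WinStep M k s (c.threshold M L s)}

variable (c M) in
/-- The potential of the memoryless controller: the excess of the counter value over the threshold,
and then the rank, ordered lexicographically. -/
noncomputable def progress (L : ℕ) (s : S) (x : ℤ) : ℤ :=
  c.excess x (c.threshold M L s) * (L + 1) - c.rank M L s

variable (c M) in
theorem bddBelow_win [Finite S] [Finite A] (i : ℕ) : BddBelow {x | ∃ s, c.Win M i s x} := by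
  induction i with
  | zero => exact ⟨0, fun _ ⟨_, h⟩ => h⟩
  | succ i ih =>
    obtain ⟨b, hb⟩ := ih
    have hpre : BddBelow (⋃ y ∈ (Set.univ : Set (S × A)), c.next y.1 y.2 ⁻¹' Set.Ici b) :=
      Set.finite_univ.bddBelow_biUnion.2 fun y _ => c.bddBelow_preimage y.1 y.2 b
    refine ((bddBelow_Ici (a := (0 : ℤ))).union hpre).mono ?_
    rintro x ⟨s, h | ⟨a, ha, h⟩⟩
    · exact Or.inl h
    · obtain ⟨t, ht⟩ := MDP.exists_step ha
      have hx : c.next s a x ∈ {x | ∃ s, c.Win M i s x} := ⟨t, h t ht⟩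
      exact Or.inr (Set.mem_biUnion (Set.mem_univ (s, a)) (hb hx))

theorem bddBelow_winStep [Finite S] [Finite A] : BddBelow {x | c.WinStep M i s x} :=
  (c.bddBelow_win M (i + 1)).mono (s := {x | c.WinStep M i s x}) fun _ h =>
    Exists.intro s (Or.inr h)

section Threshold

variable [Finite S] [Finite A]

theorem threshold_le (h : c.WinStep M L s x) : c.threshold M L s ≤ x :=
  csInf_le bddBelow_winStep h

theorem winStep_threshold (h : c.WinStep M L s x) : c.WinStep M L s (c.threshold M L s) :=
  Int.csInf_mem ⟨x, h⟩ bddBelow_winStep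

theorem winStep_rank (h : c.WinStep M L s x) :
    c.WinStep M (c.rank M L s) s (c.threshold M L s) :=
  Nat.sInf_mem (s := {k | c.WinStep M k s (c.threshold M L s)}) ⟨L, winStep_threshold h⟩

theorem rank_le (h : c.WinStep M L s x) : c.rank M L s ≤ L :=
  Nat.sInf_le (winStep_threshold h)

theorem exists_rank_eq_succ (hf : c.IsOptimal M f) {t : S} (hs : s ∈ M.states)
    (h : c.WinStep M L s x) (ht : M.Step s (f (c.rank M L s) s) t)
    (hopen : c.next s (f (c.rank M L s) s) x < 0) :
    ∃ k, c.rank M L s = k + 1 ∧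
      c.WinStep M k t (c.next s (f (c.rank M L s) s) (c.threshold M L s)) := by
  have hwin := (hf _ s hs).2 _ (winStep_rank h) t ht
  have hopen' := (c.next_mono s (f (c.rank M L s) s) (threshold_le h)).trans_lt hopen
  obtain ⟨k, hk⟩ : ∃ k, c.rank M L s = k + 1 := Nat.exists_eq_succ_of_ne_zero fun h0 =>
    hopen'.not_ge ((congrArg (fun i => c.Win M i t _) h0).mp hwin)
  exact ⟨k, hk, ((congrArg (fun i => c.Win M i t _) hk).mp hwin).winStep hopen'⟩

theorem winStep_next_and_progress_lt (hf : c.IsOptimal M f) {t : S} (hs : s ∈ M.states)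
    (h : c.WinStep M L s x) (ht : M.Step s (f (c.rank M L s) s) t)
    (hopen : c.next s (f (c.rank M L s) s) x < 0) :
    c.WinStep M L t (c.next s (f (c.rank M L s) s) x) ∧
      c.progress M L s x < c.progress M L t (c.next s (f (c.rank M L s) s) x) := by
  obtain ⟨k, hk, hnext⟩ := exists_rank_eq_succ hf hs h ht hopen
  have hvx := threshold_le h
  have hkL : k + 1 ≤ L := hk.ge.trans (rank_le h)
  have hnextL := hnext.of_le (Nat.le_of_succ_le hkL)
  have hexcess := c.excess_le_excess_next s _ x _ hvx hopen
  refine ⟨hnextL.mono (c.next_mono s _ hvx), ?_⟩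
  simp only [progress, hk]
  rw [hk] at hexcess
  rcases (threshold_le hnextL).lt_or_eq with hlt | heq
  · have hexcess' := hexcess.trans_lt (c.excess_strictAnti (c.next s (f (k + 1) s) x) (hk ▸ hlt))
    have hrank := rank_le hnextL
    nlinarith
  · have hrank : c.rank M L t ≤ k := Nat.sInf_le (heq ▸ hnext)
    rw [heq, hk]
    push_cast
    nlinarith

theorem progress_add_le (hf : c.IsOptimal M f) (hL : ∀ s ∈ M.states, c.WinStep M L s 0)
    {ρ : Run S A} (hρ : M.IsRun ρ) (hact : ∀ n, (ρ n).2 = f (c.rank M L (ρ n).1) (ρ n).1) {n : ℕ}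
    (hopen : ∀ k < n, c.val 0 (ρ.past (k + 1)) < 0) :
    c.WinStep M L (ρ n).1 (c.val 0 (ρ.past n)) ∧
      c.progress M L (ρ 0).1 0 + n ≤ c.progress M L (ρ n).1 (c.val 0 (ρ.past n)) := by
  induction n with
  | zero => exact ⟨hL _ (hρ.mem_states 0), (add_zero _).le⟩
  | succ n ih =>
    obtain ⟨hwin, hprogress⟩ := ih fun k hk => hopen k (hk.trans n.lt_succ_self)
    have hneg := hopen n n.lt_succ_self
    have hstep := hρ n
    rw [val_past_succ, hact] at hneg ⊢
    rw [hact] at hstep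
    obtain ⟨hwin', hlt⟩ := winStep_next_and_progress_lt hf (hρ.mem_states n) hwin hstep hneg
    exact ⟨hwin', by push_cast; omega⟩

theorem exists_closes_of_rank (hf : c.IsOptimal M f) (hL : ∀ s ∈ M.states, c.WinStep M L s 0) :
    ∃ N, ∀ ρ, M.IsRun ρ → (∀ n, (ρ n).2 = f (c.rank M L (ρ n).1) (ρ n).1) → c.Closes N 0 ρ := by
  obtain ⟨lo, hlo⟩ := (Set.finite_range fun s => c.progress M L s 0).bddBelow
  obtain ⟨hi, hhi⟩ :=
    (Set.finite_range fun s => c.excess 0 (c.threshold M L s) * (L + 1 : ℤ)).bddAbove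
  have le_progress (s : S) : lo ≤ c.progress M L s 0 := hlo ⟨s, rfl⟩
  have progress_le (s : S) {x : ℤ} (hx : x < 0) : c.progress M L s x ≤ hi := by
    have h1 : _ ≤ hi := hhi ⟨s, rfl⟩
    have h2 := c.excess_mono (c.threshold M L s) hx.le
    simp only [progress] at h1 h2 ⊢
    nlinarith
  refine ⟨(hi - lo).toNat + 1, fun ρ hρ hact => ?_⟩
  by_contra hopen
  simp only [Closes, not_exists, not_and, not_le] at hopen
  have hprogress := (progress_add_le hf hL hρ hact hopen).2
  have hlo := le_progress (ρ 0).1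
  have hhi := progress_le (ρ ((hi - lo).toNat + 1)).1 (hopen _ (Nat.lt_succ_self _))
  push_cast at hprogress
  omega

end Threshold

end WindowCounter

/-! ### The probability measure on runs, one letter at a time -/

section TrajMeasure

variable {X : ℕ → Type*} [∀ n, MeasurableSpace (X n)] {μ : Measure (X 0)}
  {κ : (n : ℕ) → Kernel ((i : Finset.Iic n) → X i) (X (n + 1))} [∀ n, IsMarkovKernel (κ n)]

theorem map_eval_zero_trajMeasure : (Kernel.trajMeasure μ κ).map (fun x => x 0) = μ := by
  let eval₀ (y : (i : Finset.Iic 0) → X i) : X 0 := y ⟨0, Finset.mem_Iic.2 le_rfl⟩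
  have hcomp : (fun x : (n : ℕ) → X n => x 0) = eval₀ ∘ Preorder.frestrictLe 0 := rfl
  have heval₀ : Measurable eval₀ := measurable_pi_apply _
  rw [hcomp, ← Measure.map_map heval₀ (by fun_prop), Kernel.trajMeasure,
    Measure.map_comp _ _ (by fun_prop), Kernel.traj_map_frestrictLe, Kernel.partialTraj_self,
    Measure.id_comp]
  exact (Measure.map_map heval₀ (MeasurableEquiv.measurable _)).trans Measure.map_id

theorem lintegral_trajMeasure_succ [IsProbabilityMeasure μ] {n : ℕ}
    {f : ((i : Finset.Iic n) → X i) → X (n + 1) → ENNReal} (hf : Measurable (Function.uncurry f)) :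
    ∫⁻ x, f (Preorder.frestrictLe n x) (x (n + 1)) ∂Kernel.trajMeasure μ κ =
      ∫⁻ x, ∫⁻ y, f (Preorder.frestrictLe n x) y ∂κ n (Preorder.frestrictLe n x)
        ∂Kernel.trajMeasure μ κ := by
  have h := lintegral_map (μ := Kernel.trajMeasure μ κ) hf
    (g := fun x => (Preorder.frestrictLe n x, x (n + 1))) (by fun_prop)
  rw [← Kernel.map_frestrictLe_trajMeasure_compProd_eq_map_trajMeasure,
    Measure.lintegral_compProd hf] at h
  exact h.symm.trans (lintegral_map hf.lintegral_kernel_prod_right (by fun_prop))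

end TrajMeasure

theorem ae_mem_support_toMeasure {α : Type*} [MeasurableSpace α] [Countable α]
    [MeasurableSingletonClass α] (p : PMF α) : ∀ᵐ x ∂p.toMeasure, x ∈ p.support :=
  mem_ae_iff.2 <| (p.toMeasure_apply_eq_zero_iff (Set.to_countable _).measurableSet).2
    disjoint_compl_right

theorem eq_zero_of_forall_add_le_succ {a : ℕ → ENNReal} {b c : ENNReal} (hb : b ≠ ⊤)
    (hle : ∀ n, a n ≤ b) (hsucc : ∀ n, a n + c ≤ a (n + 1)) : c = 0 := by
  have hmul (n : ℕ) : n * c ≤ a n := by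
    induction n with
    | zero => simp only [Nat.cast_zero, zero_mul, zero_le]
    | succ n ih =>
      rw [Nat.cast_succ, add_mul, one_mul]
      exact (add_le_add_left ih c).trans (hsucc n)
  by_contra hc
  obtain ⟨n, hn⟩ := ENNReal.exists_nat_mul_gt hc hb
  exact (hn.trans_le ((hmul n).trans (hle n))).false

namespace MDP.Strategy

section RunMeasure

open scoped ENNReal

attribute [local instance] letterMeasurableSpace

variable {S A : Type*} [Finite S] [Finite A] {M : MDP S A} (σ : M.Strategy)

theorem runMeasure_eq_trajMeasure (s : S) : σ.runMeasure s =
    Kernel.trajMeasure (X := fun _ => S × A) ((σ.dist [] s).map (Prod.mk s)).toMeasure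
      σ.stepKernel := by
  rw [runMeasure, Kernel.trajMeasure, PMF.toMeasure_map _ _ (MeasurableEquiv.measurable _),
    PMF.map_comp]
  rfl

instance (s : S) : IsProbabilityMeasure (σ.runMeasure s) := by
  rw [runMeasure_eq_trajMeasure]
  infer_instance

omit [Finite S] [Finite A] in
theorem extend_frestrictLe {n i : ℕ} (hi : i ≤ n) (ρ : Run S A) :
    extend n (Preorder.frestrictLe n ρ) i = ρ i := by
  simp only [extend, Preorder.frestrictLe_apply, min_eq_left hi]

omit [Finite S] [Finite A] in
theorem past_extend_frestrictLe {n i : ℕ} (hi : i ≤ n + 1) (ρ : Run S A) :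
    (extend n (Preorder.frestrictLe n ρ)).past i = ρ.past i :=
  Run.past_congr fun _ hj => extend_frestrictLe (Nat.lt_succ_iff.1 (hj.trans_le hi)) ρ

theorem measurable_past_comp {β : Type*} [MeasurableSpace β] (n : ℕ)
    (f : List (S × A) → S × A → β) : Measurable fun ρ : Run S A => f (ρ.past n) (ρ n) := by
  have hfactor : (fun ρ : Run S A => f (ρ.past n) (ρ n)) =
      (fun y : (i : Finset.Iic n) → S × A => f ((extend n y).past n) (extend n y n)) ∘
        Preorder.frestrictLe n := by
    funext ρ
    simp only [Function.comp, extend_frestrictLe le_rfl, past_extend_frestrictLe n.le_succ]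
  rw [hfactor]
  exact (measurable_of_countable _).comp (by fun_prop)

theorem lintegral_runMeasure_succ (s : S) (n : ℕ) (f : List (S × A) → S × A → ℝ≥0∞) :
    ∫⁻ ρ, f (ρ.past (n + 1)) (ρ (n + 1)) ∂σ.runMeasure s =
      ∫⁻ ρ, ∫⁻ y, f (ρ.past (n + 1)) y ∂(σ.nextLetter (ρ.past n) (ρ n)).toMeasure
        ∂σ.runMeasure s := by
  have h := lintegral_trajMeasure_succ (X := fun _ => S × A)
    (μ := ((σ.dist [] s).map (Prod.mk s)).toMeasure) (κ := σ.stepKernel) (n := n)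
    (f := fun x y => f ((extend n x).past (n + 1)) y)
    (@measurable_of_countable _ _ Prod.instMeasurableSpace _ _ _ _)
  have hkernel (ρ : Run S A) : σ.stepKernel n (Preorder.frestrictLe n ρ) =
      (σ.nextLetter (ρ.past n) (ρ n)).toMeasure := by
    rw [← past_extend_frestrictLe n.le_succ ρ, ← extend_frestrictLe le_rfl ρ]
    rfl
  simpa only [hkernel, past_extend_frestrictLe le_rfl, ← runMeasure_eq_trajMeasure] using h

theorem ae_zero (s : S) :
    ∀ᵐ ρ ∂σ.runMeasure s, (ρ 0).1 = s ∧ (ρ 0).2 ∈ (σ.dist [] s).support := by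
  have hfirst := ae_mem_support_toMeasure ((σ.dist [] s).map (Prod.mk s))
  rw [← map_eval_zero_trajMeasure (X := fun _ => S × A)
    (μ := ((σ.dist [] s).map (Prod.mk s)).toMeasure) (κ := σ.stepKernel),
    ← runMeasure_eq_trajMeasure] at hfirst
  filter_upwards [ae_of_ae_map (measurable_pi_apply 0).aemeasurable hfirst] with ρ hρ
  obtain ⟨a, ha, hρ⟩ := (PMF.mem_support_map_iff _ _ _).1 hρ
  rw [← hρ]
  exact ⟨rfl, ha⟩

theorem ae_succ (s : S) (n : ℕ) :
    ∀ᵐ ρ ∂σ.runMeasure s, ρ (n + 1) ∈ (σ.nextLetter (ρ.past n) (ρ n)).support := by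
  classical
  let f : List (S × A) → S × A → ℝ≥0∞
    | [], _ => 0
    | x :: h, y => if y ∈ (σ.nextLetter h x).support then 0 else 1
  have hzero (ρ : Run S A) :
      ∫⁻ y, f (ρ.past (n + 1)) y ∂(σ.nextLetter (ρ.past n) (ρ n)).toMeasure = 0 := by
    rw [lintegral_eq_zero_iff measurable_from_top]
    filter_upwards [ae_mem_support_toMeasure (σ.nextLetter (ρ.past n) (ρ n))] with y hy
    exact if_pos hy
  have h := σ.lintegral_runMeasure_succ s n f
  simp only [hzero, lintegral_zero] at h
  rw [lintegral_eq_zero_iff (measurable_past_comp (n + 1) f)] at h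
  filter_upwards [h] with ρ hρ
  by_contra hc
  exact one_ne_zero ((if_neg hc).symm.trans hρ)

theorem ae_isOutcome {s : S} (hs : s ∈ M.states) : ∀ᵐ ρ ∂σ.runMeasure s, σ.IsOutcome s ρ := by
  filter_upwards [σ.ae_zero s, ae_all_iff.2 (σ.ae_succ s)] with ρ h0 hsucc
  have hnext (n : ℕ) (hd : (ρ n).2 ∈ M.avail (ρ n).1) :
      M.Step (ρ n).1 (ρ n).2 (ρ (n + 1)).1 ∧
        (ρ (n + 1)).2 ∈ (σ.dist (ρ.past (n + 1)) (ρ (n + 1)).1).support := by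
    obtain ⟨d, hd⟩ := Option.isSome_iff_exists.1 hd
    have h := hsucc n
    simp only [nextLetter, hd, PMF.mem_support_bind_iff, PMF.mem_support_map_iff] at h
    obtain ⟨t, ht, a, ha, hta⟩ := h
    rw [← hta]
    exact ⟨⟨d, hd, ht⟩, ha⟩
  have hhist (n : ℕ) : M.IsHistory (ρ.past n) (ρ n).1 ∧
      (ρ n).2 ∈ (σ.dist (ρ.past n) (ρ n).1).support := by
    induction n with
    | zero => exact ⟨h0.1.symm ▸ hs, h0.1.symm ▸ h0.2⟩
    | succ n ih =>
      obtain ⟨hstep, hmem⟩ := hnext n (σ.avail _ _ ih.1 _ ih.2)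
      exact ⟨⟨ih.1, hstep⟩, hmem⟩
  exact ⟨fun n => (hnext n (σ.avail _ _ (hhist n).1 _ (hhist n).2)).1, h0.1, fun n => (hhist n).2⟩

theorem almostSure_of_ae {s : S} {E : Set (Run S A)} (h : ∀ᵐ ρ ∂σ.runMeasure s, ρ ∈ E) :
    σ.AlmostSure s E :=
  (measure_congr (Filter.eventuallyEq_univ.2 h)).trans measure_univ

/-! ### Almost sure reachability -/

omit [Finite S] [Finite A] in
theorem map_fst_nextLetter {h : List (S × A)} {x : S × A} {d : PMF S} (hd : M.δ x.1 x.2 = some d) :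
    (σ.nextLetter h x).map Prod.fst = d := by
  have hfst (t : S) : (Prod.fst ∘ fun a : A => (t, a)) = Function.const A t := rfl
  simp only [nextLetter, hd, PMF.map_bind, PMF.map_comp, hfst, PMF.map_const, PMF.bind_pure]

omit [Finite S] [Finite A] in
theorem toMeasure_nextLetter_fst {h : List (S × A)} {x : S × A} {d : PMF S}
    (hd : M.δ x.1 x.2 = some d) (t : S) :
    (σ.nextLetter h x).toMeasure {y | y.1 = t} = d t := by
  rw [PMF.toMeasure_apply_eq_toOuterMeasure_apply _ MeasurableSpace.measurableSet_top,
    ← σ.map_fst_nextLetter (h := h) hd, ← PMF.toOuterMeasure_apply_singleton,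
    PMF.toOuterMeasure_map_apply]
  rfl

theorem exists_two_mul_le_apply (M : MDP S A) : ∃ q : ℝ≥0∞, q ≠ 0 ∧ q ≤ 1 ∧
    ∀ s a t d, M.δ s a = some d → t ∈ d.support → 2 * q ≤ d t := by
  have hsmall : ∀ᶠ q in nhdsWithin (0 : ℝ≥0∞) (Set.Ioi 0),
      ∀ s a t d, M.δ s a = some d → t ∈ d.support → 2 * q ≤ d t := by
    simp only [Filter.eventually_all]
    intro s a t
    rcases M.δ s a with - | d
    · exact .of_forall fun _ _ hd => nomatch hd
    by_cases ht : t ∈ d.support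
    · have hpos : 0 < d t / 2 := ENNReal.half_pos ((PMF.mem_support_iff _ _).1 ht)
      filter_upwards [Ioc_mem_nhdsGT hpos] with q hq d' hd' _
      obtain rfl := Option.some.inj hd'
      exact (mul_le_mul_right hq.2 2).trans
        (ENNReal.mul_div_cancel two_ne_zero ENNReal.ofNat_ne_top).le
    · exact .of_forall fun _ _ hd' ht' => (ht (Option.some.inj hd' ▸ ht')).elim
  obtain ⟨q, hq, hq01⟩ := (hsmall.and (Ioc_mem_nhdsGT zero_lt_one)).exists
  exact ⟨q, hq01.1.ne', hq01.2, hq⟩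

open scoped Classical in
/-- The potential of a word in the drift argument for reaching `T`: it is `1` once `T` has been
visited, and `q ^ dist s` in a state `s` before that. -/
noncomputable def reachPotential (T : Set S) (dist : S → ℕ) (q : ℝ≥0∞) (h : List (S × A))
    (x : S × A) : ℝ≥0∞ :=
  if ∃ y ∈ x :: h, y.1 ∈ T then 1 else q ^ dist x.1

variable {T : Set S} {dist : S → ℕ} {q : ℝ≥0∞}

omit [Finite S] [Finite A] in
theorem reachPotential_le_one (hq : q ≤ 1) (h : List (S × A)) (x : S × A) :
    reachPotential T dist q h x ≤ 1 := by
  unfold reachPotential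
  split_ifs
  · exact le_rfl
  · exact pow_le_one' hq _

omit [Finite S] [Finite A] in
theorem pow_dist_le_reachPotential (hq : q ≤ 1) (h : List (S × A)) (x : S × A) :
    q ^ dist x.1 ≤ reachPotential T dist q h x := by
  unfold reachPotential
  split_ifs
  · exact pow_le_one' hq _
  · exact le_rfl

omit [Finite S] [Finite A] in
theorem two_mul_pow_dist_le_lintegral (hq : q ≤ 1) {h : List (S × A)} {x : S × A} {t : S}
    {d : PMF S} (hd : M.δ x.1 x.2 = some d) (hdt : 2 * q ≤ d t) (hlt : dist t < dist x.1) :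
    2 * q ^ dist x.1 ≤
      ∫⁻ y, reachPotential T dist q (x :: h) y ∂(σ.nextLetter h x).toMeasure :=
  calc 2 * q ^ dist x.1
      ≤ 2 * q ^ (dist t + 1) := by gcongr 2 * ?_; exact pow_le_pow_right_of_le_one' hq hlt
    _ = q ^ dist t * (2 * q) := by ring
    _ ≤ q ^ dist t * (σ.nextLetter h x).toMeasure {y | y.1 = t} := by
      rw [σ.toMeasure_nextLetter_fst hd]
      gcongr
    _ = ∫⁻ y, {y : S × A | y.1 = t}.indicator (fun _ => q ^ dist t) y
          ∂(σ.nextLetter h x).toMeasure :=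
      (lintegral_indicator_const MeasurableSpace.measurableSet_top _).symm
    _ ≤ _ := lintegral_mono fun y =>
      Set.indicator_le' (fun y hy => hy ▸ pow_dist_le_reachPotential hq _ y)
        (fun _ _ => zero_le) y

theorem lintegral_reachPotential_add_le (hq : q ≤ 1)
    (hqd : ∀ s a t d, M.δ s a = some d → t ∈ d.support → 2 * q ≤ d t) {D : ℕ}
    (hD : ∀ t, dist t ≤ D) {s : S} (hs : s ∈ M.states)
    (hdec : ∀ ρ, σ.IsOutcome s ρ → ∀ n, (ρ n).1 ∉ T →
      ∃ t, M.Step (ρ n).1 (ρ n).2 t ∧ dist t < dist (ρ n).1) (n : ℕ) :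
    ∫⁻ ρ, reachPotential T dist q (ρ.past n) (ρ n) ∂σ.runMeasure s +
        q ^ D * σ.runMeasure s {ρ | ∀ i, (ρ i).1 ∉ T} ≤
      ∫⁻ ρ, reachPotential T dist q (ρ.past (n + 1)) (ρ (n + 1)) ∂σ.runMeasure s := by
  have hmeas : MeasurableSet {ρ : Run S A | ∀ i, (ρ i).1 ∉ T} := by
    rw [Set.ofPred_forall]
    exact .iInter fun i => measurableSet_setOfPred.2 (measurable_past_comp i fun _ x => x.1 ∉ T)
  rw [lintegral_runMeasure_succ, ← lintegral_indicator_const hmeas,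
    ← lintegral_add_left (measurable_past_comp n (reachPotential T dist q))]
  refine lintegral_mono_ae ?_
  filter_upwards [σ.ae_isOutcome hs] with ρ hρ
  by_cases hvisit : ∃ y ∈ ρ n :: ρ.past n, y.1 ∈ T
  · have hout : ρ ∉ {ρ : Run S A | ∀ i, (ρ i).1 ∉ T} := by
      obtain ⟨y, hy, hyT⟩ := hvisit
      obtain ⟨i, rfl⟩ := Run.exists_eq_of_mem_past (n := n + 1) hy
      exact fun hρT => hρT i hyT
    have hone (y : S × A) : reachPotential T dist q (ρ.past (n + 1)) y = 1 := by
      obtain ⟨z, hz, hzT⟩ := hvisit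
      exact if_pos ⟨z, List.mem_cons_of_mem _ hz, hzT⟩
    simp only [hone, lintegral_one, measure_univ, Set.indicator_of_notMem hout, add_zero]
    exact reachPotential_le_one hq _ _
  · obtain ⟨t, ⟨d, hd, htd⟩, hlt⟩ :=
      hdec ρ hρ n fun hT => hvisit ⟨_, List.mem_cons_self, hT⟩
    refine le_trans ?_ (σ.two_mul_pow_dist_le_lintegral hq hd (hqd _ _ _ _ hd htd) hlt)
    rw [two_mul]
    refine add_le_add (if_neg hvisit).le ((Set.indicator_le_self' (fun _ _ => zero_le) ρ).trans ?_)
    exact pow_le_pow_right_of_le_one' hq (hD _)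

theorem ae_exists_mem_of_dist {s : S} (hs : s ∈ M.states)
    (hdec : ∀ ρ, σ.IsOutcome s ρ → ∀ n, (ρ n).1 ∉ T →
      ∃ t, M.Step (ρ n).1 (ρ n).2 t ∧ dist t < dist (ρ n).1) :
    ∀ᵐ ρ ∂σ.runMeasure s, ∃ i, (ρ i).1 ∈ T := by
  obtain ⟨q, hq0, hq1, hqd⟩ := exists_two_mul_le_apply M
  obtain ⟨D, hD⟩ := (Set.finite_range dist).bddAbove
  have hle (n : ℕ) :
      ∫⁻ ρ, reachPotential T dist q (ρ.past n) (ρ n) ∂σ.runMeasure s ≤ 1 :=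
    (lintegral_mono fun _ => reachPotential_le_one hq1 _ _).trans (by simp)
  have hnull := eq_zero_of_forall_add_le_succ ENNReal.one_ne_top hle
    (σ.lintegral_reachPotential_add_le hq1 hqd (fun t => hD ⟨t, rfl⟩) hs hdec)
  have hnull := (mul_eq_zero.1 hnull).resolve_left (pow_ne_zero _ hq0)
  filter_upwards [measure_eq_zero_iff_ae_notMem.1 hnull] with ρ hρ
  simpa using hρ

end RunMeasure
end MDP.Strategy

/-! ### Reaching a sub-MDP and staying there -/

theorem exists_dist_lt_of_reflTransGen {α : Type*} (r : α → α → Prop) (t : α) :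
    ∃ dist : α → ℕ, ∀ s, Relation.ReflTransGen r s t → s ≠ t → ∃ u, r s u ∧ dist u < dist s := by
  let pre (D : Set α) : Set α := {s | ∃ u ∈ D, r s u}
  refine ⟨fun s => sInf {n | s ∈ pre^[n] {t}}, fun s hst hne => ?_⟩
  have hlayer : ∃ n, s ∈ pre^[n] {t} := by
    refine hst.head_induction_on ⟨0, rfl⟩ fun hab _ ⟨n, hn⟩ => ⟨n + 1, ?_⟩
    rw [Function.iterate_succ_apply']
    exact ⟨_, hn, hab⟩
  have hmem : s ∈ pre^[sInf {n | s ∈ pre^[n] {t}}] {t} := Nat.sInf_mem hlayer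
  cases hd : sInf {n | s ∈ pre^[n] {t}} with
  | zero => exact (hne (by rwa [hd] at hmem)).elim
  | succ n =>
    rw [hd, Function.iterate_succ_apply'] at hmem
    obtain ⟨u, hu, hsu⟩ := hmem
    exact ⟨u, hsu, (Nat.sInf_le hu).trans_lt (n.lt_succ_self.trans_eq hd.symm)⟩

theorem MDP.StronglyConnected.exists_attractor {S A : Type*} {C : MDP S A}
    (hconn : C.StronglyConnected) {t : S} (ht : t ∈ C.states) :
    ∃ (dist : S → ℕ) (f : S → A), ∀ s ∈ C.states, s ≠ t →
      ∃ u, C.Step s (f s) u ∧ dist u < dist s := by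
  have : Nonempty A := (C.deadlockFree t ht).nonempty
  obtain ⟨dist, hdist⟩ := exists_dist_lt_of_reflTransGen (fun x y => ∃ a, C.Step x a y) t
  have hex (s : S) : ∃ a, s ∈ C.states → s ≠ t → ∃ u, C.Step s a u ∧ dist u < dist s := by
    by_cases hs : s ∈ C.states ∧ s ≠ t
    · obtain ⟨u, ⟨a, hsu⟩, hlt⟩ := hdist s (hconn s hs.1 t ht) hs.2
      exact ⟨a, fun _ _ => ⟨u, hsu, hlt⟩⟩
    · exact ⟨Classical.arbitrary A, fun h h' => (hs ⟨h, h'⟩).elim⟩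
  choose f hf using hex
  exact ⟨dist, f, hf⟩

namespace MDP.Mealy

variable {S A Q : Type*} {M : MDP S A}

/-- The strategy encoded by a Mealy machine. -/
noncomputable def toStrategy (m : M.Mealy Q) : M.Strategy where
  dist h s := m.act s (m.mem h)
  avail _ s hh := m.avail s hh.mem_states _

end MDP.Mealy

namespace Controller

variable {S A Q : Type*} {κ : Controller S A Q} {M C C' : MDP S A}

/-- The controller only chooses actions of `M`. -/
def IsValid (κ : Controller S A Q) (M : MDP S A) : Prop :=
  ∀ s ∈ M.states, ∀ q, κ.act s q ∈ M.avail s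

/-- A controller with an initial memory state, as a Mealy machine with Dirac distributions. -/
noncomputable def toMealy (hκ : κ.IsValid M) (q₀ : Q) : M.Mealy Q where
  init := q₀
  act s q := PMF.pure (κ.act s q)
  upd := κ.upd
  avail s hs q _ ha := (PMF.mem_support_pure_iff _ _).1 ha ▸ hκ s hs q

theorem follows_of_isOutcome {hκ : κ.IsValid M} {q₀ : Q} {s : S} {ρ : Run S A}
    (hρ : (κ.toMealy hκ q₀).toStrategy.IsOutcome s ρ) :
    κ.Follows (fun n => (κ.toMealy hκ q₀).mem (ρ.past n)) ρ :=
  fun n => ⟨(PMF.mem_support_pure_iff _ _).1 (hρ.2.2 n), rfl⟩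

open scoped Classical in
/-- The controller that plays like `κ` in the states of `C'` and chooses the action `f s` in any
other state `s`. -/
noncomputable def patch (κ : Controller S A Q) (C' : MDP S A) (f : S → A) : Controller S A Q where
  act s q := if s ∈ C'.states then κ.act s q else f s
  upd := κ.upd

variable {f : S → A}

theorem IsValid.patch (hκ : κ.IsValid C') (hsub : C'.IsSubMDP C)
    (hf : ∀ s ∈ C.states, s ∉ C'.states → f s ∈ C.avail s) : (κ.patch C' f).IsValid C := by
  intro s hs q
  simp only [Controller.patch]
  split_ifs with hs'
  · exact hsub.avail_subset s (hκ s hs' q)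
  · exact hf s hs hs'

theorem IsValid.isRun_and_follows_of_patch (hκ : κ.IsValid C') (hsub : C'.IsSubMDP C)
    {ρ : Run S A} (hρ : C.IsRun ρ) {m : ℕ → Q} (hm : (κ.patch C' f).Follows m ρ)
    (h0 : (ρ 0).1 ∈ C'.states) : C'.IsRun ρ ∧ κ.Follows m ρ := by
  have hact (n : ℕ) (hn : (ρ n).1 ∈ C'.states) : (ρ n).2 = κ.act (ρ n).1 (m n) :=
    (hm n).1.trans (if_pos hn)
  have hstep (n : ℕ) (hn : (ρ n).1 ∈ C'.states) : C'.Step (ρ n).1 (ρ n).2 (ρ (n + 1)).1 :=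
    hsub.step_of_mem_avail (hact n hn ▸ hκ _ hn (m n)) (hρ n)
  have hstay (n : ℕ) : (ρ n).1 ∈ C'.states := by
    induction n with
    | zero => exact h0
    | succ n ih => exact (hstep n ih).mem_states
  exact ⟨fun n => hstep n (hstay n), fun n => ⟨hact n (hstay n), (hm n).2⟩⟩

theorem IsValid.exists_reachesThenWins [Finite S] [Finite A] {K : ℕ}
    {κ : Controller S A (Fin K)} (hκ : κ.IsValid C') (q₀ : Fin K) (hsub : C'.IsSubMDP C)
    (hne : C'.states.Nonempty) (hconn : C.StronglyConnected) {E : Set (Run S A)}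
    (hE : ∀ m ρ, C'.IsRun ρ → κ.Follows m ρ → ρ ∈ E) :
    ∃ σ : C.Strategy, σ.IsPure ∧ σ.HasMemory K ∧ σ.ReachesThenWins C' E := by
  obtain ⟨t, ht⟩ := hne
  obtain ⟨dist, f, hf⟩ := hconn.exists_attractor (hsub.1 ht)
  have hf (s : S) (hs : s ∈ C.states) (hs' : s ∉ C'.states) :
      ∃ u, C.Step s (f s) u ∧ dist u < dist s := hf s hs fun h => hs' (h ▸ ht)
  have hpatch : (κ.patch C' f).IsValid C := hκ.patch hsub fun s hs hs' =>
    (hf s hs hs').choose_spec.1.mem_avail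
  let m := (κ.patch C' f).toMealy hpatch q₀
  refine ⟨m.toStrategy, fun _ _ _ => ⟨_, rfl⟩, ⟨m, fun _ _ _ => rfl⟩, fun s hs => ⟨?_, ?_⟩⟩
  · refine m.toStrategy.almostSure_of_ae
      (m.toStrategy.ae_exists_mem_of_dist (T := C'.states) (dist := dist) hs fun ρ hρ n hn => ?_)
    have hact : (ρ n).2 = f (ρ n).1 := (follows_of_isOutcome hρ n).1.trans (if_neg hn)
    exact hact ▸ hf _ (hρ.1.mem_states n) hn
  · intro ρ hρ i hi _
    obtain ⟨hrun, hfollows⟩ := hκ.isRun_and_follows_of_patch hsub (hρ.1.suffix i)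
      ((follows_of_isOutcome hρ).suffix i) hi
    exact ⟨hrun, hE _ _ hrun hfollows⟩

end Controller

attribute [local instance] letterMeasurableSpace in
theorem MDP.Strategy.ReachesThenWins.almostSure {S A : Type*} [Finite S] [Finite A] {C C' : MDP S A}
    {σ : C.Strategy} {E F : Set (Run S A)} (hσ : σ.ReachesThenWins C' E)
    (hF : ∀ ρ, C.IsRun ρ → ∀ i, ρ.suffix i ∈ E → ρ ∈ F) {s : S} (hs : s ∈ C.states) :
    σ.AlmostSure s F := by
  classical
  obtain ⟨hreach, hwin⟩ := hσ s hs
  have hmeas : MeasurableSet {ρ : Run S A | ∃ i, (ρ i).1 ∈ C'.states} := by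
    rw [Set.ofPred_exists]
    exact .iUnion fun i =>
      measurableSet_setOfPred.2 (measurable_past_comp i fun _ x => x.1 ∈ C'.states)
  refine σ.almostSure_of_ae ?_
  filter_upwards [(mem_ae_iff_prob_eq_one hmeas).2 hreach, σ.ae_isOutcome hs] with ρ hvisit hρ
  exact hF ρ hρ.1 _ (hwin ρ hρ (Nat.find hvisit) (Nat.find_spec hvisit)
    fun _ hj => Nat.find_min hvisit hj).2

/-! ### Safe end-components -/

namespace MDP.IsSafe

variable {S A : Type*} {C : MDP S A} {Ω : WindowKind S A}

theorem winStep {c : WindowCounter S A} (hc : c.Describes Ω) {L : ℕ} (h : C.IsSafe Ω (L + 1)) :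
    ∀ s ∈ C.states, c.WinStep C L s 0 := by
  obtain ⟨σ, hσ⟩ := h
  intro s hs
  refine WindowCounter.winStep_of_sure σ hs fun ρ hρ => ?_
  have hclosed := (hc.mem_DFW.1 (hσ s hs ρ hρ)).2 0
  rwa [Run.suffix_zero] at hclosed

variable [Finite S] [Finite A] {lam : ℕ}

theorem exists_fixedWindow_controller (hsafe : C.IsSafe Ω lam) (hne : C.states.Nonempty)
    (hlam : 0 < lam) : ∃ κ : Controller S A (Fin lam), κ.IsValid C ∧
      ∀ m ρ, C.IsRun ρ → κ.Follows m ρ → ρ ∈ C.DFW Ω lam := by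
  obtain ⟨L, rfl⟩ := Nat.exists_eq_add_one_of_ne_zero hlam.ne'
  have : Nonempty A := (C.deadlockFree _ hne.choose_spec).nonempty
  obtain ⟨c, hc⟩ := WindowCounter.exists_describes Ω
  obtain ⟨f, hf⟩ := c.exists_isOptimal C
  refine ⟨c.fixedWindowController C f L, fun s hs q => (hf _ s hs).1, fun m ρ hρ hm => ?_⟩
  exact hc.mem_DFW.2 ⟨hρ, fun j =>
    WindowCounter.closes_fixedWindow hf (hsafe.winStep hc) (hρ.suffix j) (hm.suffix j)⟩

theorem exists_boundedWindow_controller (hsafe : C.IsSafe Ω lam) (hne : C.states.Nonempty)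
    (hlam : 0 < lam) : ∃ κ : Controller S A (Fin 1), κ.IsValid C ∧
      ∀ m ρ, C.IsRun ρ → κ.Follows m ρ → ρ ∈ C.DBW Ω := by
  obtain ⟨L, rfl⟩ := Nat.exists_eq_add_one_of_ne_zero hlam.ne'
  have : Nonempty A := (C.deadlockFree _ hne.choose_spec).nonempty
  obtain ⟨c, hc⟩ := WindowCounter.exists_describes Ω
  obtain ⟨f, hf⟩ := c.exists_isOptimal C
  obtain ⟨N, hN⟩ := WindowCounter.exists_closes_of_rank hf (hsafe.winStep hc)
  refine ⟨⟨fun s _ => f (c.rank C L s) s, fun _ _ q => q⟩, fun s hs _ => (hf _ s hs).1,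
    fun m ρ hρ hm => ⟨N + 1, N.succ_pos, hc.mem_DFW.2 ⟨hρ, fun j => ?_⟩⟩⟩
  obtain ⟨l, hl, hclosed⟩ := hN _ (hρ.suffix j) fun n => (hm (j + n)).1
  exact ⟨l, hl.trans N.lt_succ_self, hclosed⟩

end MDP.IsSafe

theorem proposition5p5_general {S A : Type*} [Finite S] [Finite A] {C' C : MDP S A}
    (hsub : C'.IsSubMDP C) (hne : C'.states.Nonempty) (hconn : C.StronglyConnected)
    {Ω : WindowKind S A} {lam : ℕ} (hlam : 0 < lam) (hsafe : C'.IsSafe Ω lam) :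
    (∃ σ : C.Strategy, σ.IsPure ∧ σ.HasMemory lam ∧ (∀ s ∈ C.states, σ.AlmostSure s (C.FW Ω lam)) ∧
      σ.ReachesThenWins C' (C'.DFW Ω lam)) ∧
    (∃ σ : C.Strategy, σ.IsPure ∧ σ.IsMemoryless ∧ (∀ s ∈ C.states, σ.AlmostSure s (C.BW Ω)) ∧
      σ.ReachesThenWins C' (C'.DBW Ω)) := by
  constructor
  · obtain ⟨κ, hκ, hwin⟩ := hsafe.exists_fixedWindow_controller hne hlam
    obtain ⟨σ, hpure, hmem, hreach⟩ := hκ.exists_reachesThenWins ⟨0, hlam⟩ hsub hne hconn hwin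
    refine ⟨σ, hpure, hmem, fun s hs => hreach.almostSure ?_ hs, hreach⟩
    exact fun ρ hρ i hi => ⟨hρ, i, hsub.DFW_subset Ω lam hi⟩
  · obtain ⟨κ, hκ, hwin⟩ := hsafe.exists_boundedWindow_controller hne hlam
    obtain ⟨σ, hpure, hmem, hreach⟩ := hκ.exists_reachesThenWins 0 hsub hne hconn hwin
    refine ⟨σ, hpure, hmem, fun s hs => hreach.almostSure ?_ hs, hreach⟩
    rintro ρ hρ i ⟨N, hN, hi⟩
    exact ⟨hρ, N, hN, hρ, i, hsub.DFW_subset Ω N hi⟩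

theorem proposition5p5 :
    (∃ P : Polynomial ℕ, ∀ (S : Type u) (A : Type v) [Finite S] [Finite A] (M C : MDP S A)
      (Ω : WindowKind S A) (lam : ℕ), 0 < lam → C.IsEC M → C.IsGood M Ω lam →
      ∃ σ : C.Strategy,
        σ.IsPure ∧
        (∃ K ≤ P.eval (C.states.card + lam), σ.HasMemory K) ∧
        (∀ s ∈ C.states, σ.AlmostSure s (C.FW Ω lam)) ∧
        ∃ C' : MDP S A, C'.IsSubEC C M ∧ C'.IsSafe Ω lam ∧
          σ.ReachesThenWins C' (C'.DFW Ω lam)) ∧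
    (∀ (S : Type u) (A : Type v) [Finite S] [Finite A] (M C : MDP S A)
      (Ω : WindowKind S A), C.IsEC M → C.IsBWGood M Ω →
      ∃ σ : C.Strategy,
        σ.IsPure ∧
        σ.IsMemoryless ∧
        (∀ s ∈ C.states, σ.AlmostSure s (C.BW Ω)) ∧
        ∃ C' : MDP S A, C'.IsSubEC C M ∧ (∃ lam > 0, C'.IsSafe Ω lam) ∧
          σ.ReachesThenWins C' (C'.DBW Ω)) := by
  refine ⟨⟨Polynomial.X, ?_⟩, ?_⟩
  · rintro S A _ _ M C Ω lam hlam hC ⟨C', hsub, hsafe⟩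
    obtain ⟨σ, hpure, hmem, hFW, hreach⟩ :=
      (proposition5p5_general hsub.1 hsub.2.2.1 hC.2.2 hlam hsafe).1
    exact ⟨σ, hpure, ⟨lam, by simp, hmem⟩, hFW, C', hsub, hsafe, hreach⟩
  · rintro S A _ _ M C Ω hC ⟨C', hsub, lam, hlam, hsafe⟩
    obtain ⟨σ, hpure, hmem, hBW, hreach⟩ :=
      (proposition5p5_general hsub.1 hsub.2.2.1 hC.2.2 hlam hsafe).2
    exact ⟨σ, hpure, hmem, hBW, C', hsub, ⟨lam, hlam, hsafe⟩, hreach⟩
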